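/- Theorem 3.2 (Clarkson's inequality). Let $E$ be a Dedekind complete Riesz space with a weak order unit $e$. Let $E^u$ be its universal completion, i.e. a universally complete (Dedekind complete and laterally complete) Riesz space containing $E$ as an order dense Riesz subspace, equipped with its $f$-algebra multiplication for which $e$ is the multiplicative unit. For $0\le z\in E^u$ let $(e_t)_{t\in\mathbb R}$ be the spectral system of $z$ with respect to $e$, that is, $e_t=e-P_t e$, where $P_t$ is the projection onto the band generated by $(z-te)^+$. For $p\ge 1$ let $z^p=\int t^p\,de_t$ be given by functional calculus, i.e. with $f_p(t)=\max(t,0)^p$, $$z^p=\sup\Big\{\sum_{i=0}^{n-1}c_i\,(e_{t_{i+1}}-e_{t_i}) : n\ge 0,\ t_0\le t_1\le\dots\le t_n,\ c_i\in\mathbb R,\ c_i\le f_p(s)\text{ for all }s\in(t_i,t_{i+1}]\Big\}.$$ Let $1\le p\le 2$. Then $|z|^p$ exists in $E^u$ for every $z\in E^u$ (the set above, formed for $|z|$, is bounded above), and for all $x,y\in E^u$, $$|x+y|^p+|x-y|^p\le 2\big(|x|^p+|y|^p\big).$$ -/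

import Mathlib

/-- `e` is a weak order unit of a Riesz space: `e` is positive and the only element disjoint
from `e` is `0`. -/
def IsWeakOrderUnit {E : Type*} [Lattice E] [AddCommGroup E] (e : E) : Prop :=
  0 ≤ e ∧ ∀ x : E, e ⊓ |x| = 0 → x = 0

/-- A Riesz space is laterally complete if every nonempty set of positive, pairwise disjoint
elements has a supremum. -/
def IsLaterallyComplete (U : Type*) [Lattice U] [AddCommGroup U] : Prop :=
  ∀ S : Set U, S.Nonempty → (∀ a ∈ S, 0 ≤ a) → S.Pairwise (fun a b => a ⊓ b = 0) →
    ∃ b : U, IsLUB S b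

/-- `ι : E → U` exhibits `U` as the universal completion of the Riesz space `E`: the Riesz space
`U` is universally complete, that is, Dedekind complete (here `ConditionallyCompleteLattice`) and
laterally complete, and `ι` is an injective Riesz homomorphism whose range is order dense. -/
structure IsUniversalCompletion {E U : Type*} [Lattice E] [AddCommGroup E] [Module ℝ E]
    [ConditionallyCompleteLattice U] [AddCommGroup U] [Module ℝ U] (ι : E →ₗ[ℝ] U) : Prop where
  laterallyComplete : IsLaterallyComplete U
  injective : Function.Injective ι
  map_sup : ∀ x y : E, ι (x ⊔ y) = ι x ⊔ ι y
  orderDense : ∀ u : U, 0 < u → ∃ x : E, 0 < x ∧ ι x ≤ u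

/-- The axioms of an f-algebra for a real algebra `U` which is also a Riesz space: products of
positive elements are positive, and multiplication by a positive element, on either side,
preserves disjointness. -/
class IsFAlgebra (U : Type*) [Lattice U] [Ring U] : Prop where
  mul_nonneg : ∀ x y : U, 0 ≤ x → 0 ≤ y → 0 ≤ x * y
  mul_left_disjoint : ∀ x y z : U, x ⊓ y = 0 → 0 ≤ z → (z * x) ⊓ y = 0
  mul_right_disjoint : ∀ x y z : U, x ⊓ y = 0 → 0 ≤ z → (x * z) ⊓ y = 0

section SpectralCalculus

variable {U : Type*} [ConditionallyCompleteLattice U] [AddCommGroup U] [Module ℝ U]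

/-- The projection of `u ≥ 0` onto the band generated by `v ≥ 0`, i.e. `sup_n (u ⊓ n v)`
(a supremum of a set bounded above by `u`). -/
noncomputable def bandProj (v u : U) : U :=
  sSup (Set.range fun n : ℕ => u ⊓ n • v)

/-- The (right-continuous) spectral system of `x` with respect to the weak order unit `u`:
`e_t = u - P u`, with `P` the projection onto the band generated by `(x - t u)⁺`.
For functions and `u = 1`, `e_t` is the indicator function of `{x ≤ t}`. -/
noncomputable def spectralSystem (u x : U) (t : ℝ) : U :=
  u - bandProj ((x - t • u) ⊔ 0) u

/-- The integrals `∑ c_i (e_{t_{i+1}} - e_{t_i})`, against the spectral system of `x`, of the step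
functions `∑ c_i 1_{(t_i, t_{i+1}]}`, `t_0 ≤ t_1 ≤ … ≤ t_n`, that lie below the nonnegative
function `f`. -/
def lowerSpectralSums (u x : U) (f : ℝ → ℝ) : Set U :=
  {z | ∃ (n : ℕ) (t c : ℕ → ℝ), Monotone t ∧
    (∀ i < n, ∀ s ∈ Set.Ioc (t i) (t (i + 1)), c i ≤ f s) ∧
    z = ∑ i ∈ Finset.range n, c i • (spectralSystem u x (t (i + 1)) - spectralSystem u x (t i))}

/-- The functional calculus `f(x) = ∫ f(t) de_t` (Daniell integral against the spectral system of
`x` with respect to `u`) for a nonnegative continuous function `f`: the supremum of the integrals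
of the step functions below `f`. -/
noncomputable def functionalCalculus (u x : U) (f : ℝ → ℝ) : U :=
  sSup (lowerSpectralSums u x f)

/-- The real function `t ↦ t ^ p` on `[0, ∞)`, extended by its value at `0` to negative `t`. -/
noncomputable def powFun (p : ℝ) (t : ℝ) : ℝ := (max t 0) ^ p

/-- The power `x ^ p` of `x ≥ 0` given by the functional calculus with respect to `u`. -/
noncomputable def rieszPow (u x : U) (p : ℝ) : U := functionalCalculus u x (powFun p)

end SpectralCalculus

/-! Multiplying by a component of the unit acts like restricting a function to a set, so the
inequality reduces to the one for real numbers. If it failed, the difference of the two sides would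
be at least some `δ > 0` on a nonzero component (`exists_component_smul_le`). Cells of the spectral
systems of `x` and `y` cut out a smaller nonzero component where both are within `ε` of real
constants `α`, `β` (`exists_component_near_const`). There each power is squeezed between nearby
values of `powFun p` (`mul_functionalCalculus_abs_bounds`), and for small `ε` this contradicts
`abs_add_rpow_add_abs_sub_rpow_le` at `α`, `β`.

The powers exist because lateral completeness glues constant bounds on the disjoint unit cells into
one element; the same localisation shows that it dominates every lower sum. -/

/-- `q` is a component of the unit: it is disjoint from its complement `1 - q`. -/
def IsUnitComponent {U : Type*} [Lattice U] [Ring U] (q : U) : Prop := q ⊓ (1 - q) = 0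

/-! ### Archimedean property and disjointness in an f-algebra -/

section FAlgebra

set_option linter.unusedSectionVars false

variable {U : Type*} [ConditionallyCompleteLattice U] [Ring U] [IsOrderedRing U]

/-- Dedekind completeness gives the Archimedean property: the supremum of the multiples is unchanged
by a shift of the index. -/
lemma nonpos_of_forall_nsmul_le {x y : U} (h : ∀ n : ℕ, n • x ≤ y) : x ≤ 0 := by
  have hb : BddAbove (Set.range fun n : ℕ => n • x) := ⟨y, by rintro _ ⟨n, rfl⟩; exact h n⟩
  have : sSup (Set.range fun n : ℕ => n • x) ≤ sSup (Set.range fun n : ℕ => n • x) - x := by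
    apply csSup_le (Set.range_nonempty _)
    rintro _ ⟨n, rfl⟩
    rw [le_sub_iff_add_le]
    exact le_csSup hb ⟨n + 1, succ_nsmul x n⟩
  simpa using this

variable [IsFAlgebra U]

/-- Two uses of the f-algebra axioms make `a * b` disjoint from itself. -/
lemma mul_eq_zero_of_inf_eq_zero {a b : U} (h : a ⊓ b = 0) : a * b = 0 := by
  have ha : 0 ≤ a := h ▸ inf_le_left
  have hb : 0 ≤ b := h ▸ inf_le_right
  have h1 : (a * b) ⊓ b = 0 := IsFAlgebra.mul_right_disjoint a b b h hb
  rw [inf_comm] at h1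
  simpa using IsFAlgebra.mul_left_disjoint b (a * b) a h1 ha

lemma nsmul_inf_eq_zero {a b : U} (h : a ⊓ b = 0) (n : ℕ) : (n • a) ⊓ b = 0 := by
  have := IsFAlgebra.mul_left_disjoint a b (n • (1 : U)) h (nsmul_nonneg zero_le_one n)
  simpa using this

/-! ### Components of the unit as idempotents -/

namespace IsUnitComponent

variable {q r : U}

lemma nonneg (hq : IsUnitComponent q) : 0 ≤ q := by
  unfold IsUnitComponent at hq; exact hq ▸ inf_le_left

lemma one_sub_nonneg (hq : IsUnitComponent q) : 0 ≤ 1 - q := by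
  unfold IsUnitComponent at hq; exact hq ▸ inf_le_right

lemma le_one (hq : IsUnitComponent q) : q ≤ 1 := sub_nonneg.1 hq.one_sub_nonneg

lemma one_sub (hq : IsUnitComponent q) : IsUnitComponent (1 - q) := by
  unfold IsUnitComponent at *; rw [sub_sub_cancel, inf_comm, hq]

lemma mul_one_sub (hq : IsUnitComponent q) : q * (1 - q) = 0 := mul_eq_zero_of_inf_eq_zero hq

lemma mul_self (hq : IsUnitComponent q) : q * q = q := by
  have := hq.mul_one_sub
  rw [mul_sub, mul_one, sub_eq_zero] at this
  exact this.symm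

lemma mul_le_right (hq : IsUnitComponent q) {z : U} (hz : 0 ≤ z) : q * z ≤ z := by
  simpa using mul_le_mul_of_nonneg_right hq.le_one hz

lemma mul_le_left (hq : IsUnitComponent q) {z : U} (hz : 0 ≤ z) : z * q ≤ z := by
  simpa using mul_le_mul_of_nonneg_left hq.le_one hz

lemma mul_eq_inf (hq : IsUnitComponent q) (hr : IsUnitComponent r) : q * r = q ⊓ r := by
  apply le_antisymm (le_inf (hr.mul_le_left hq.nonneg) (hq.mul_le_right hr.nonneg))
  have h : (q * (1 - r)) ⊓ r = 0 := IsFAlgebra.mul_left_disjoint _ _ _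
    (by rw [inf_comm]; exact hr) hq.nonneg
  have h2 : q ⊓ r - q * r ≤ (q * (1 - r)) ⊓ r := by
    apply le_inf
    · rw [mul_sub, mul_one]; exact sub_le_sub_right inf_le_left _
    · exact (sub_le_self _ (mul_nonneg hq.nonneg hr.nonneg)).trans inf_le_right
  rw [h] at h2
  exact sub_nonpos.1 h2

/-- The ring is not assumed commutative; components commute because their product is their infimum.
-/
lemma mul_comm (hq : IsUnitComponent q) (hr : IsUnitComponent r) : q * r = r * q := by
  rw [hq.mul_eq_inf hr, hr.mul_eq_inf hq, inf_comm]

lemma mul (hq : IsUnitComponent q) (hr : IsUnitComponent r) : IsUnitComponent (q * r) := by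
  unfold IsUnitComponent
  have h1 : q ⊓ (1 - q) = 0 := hq
  have h2 : r ⊓ (1 - r) = 0 := hr
  have e1 : (q * r) * (1 - q * r) = 0 := by
    rw [mul_sub, mul_one, mul_assoc, ← mul_assoc r, hr.mul_comm hq, mul_assoc q r r, hr.mul_self,
      ← mul_assoc, hq.mul_self, sub_self]
  have hn : 0 ≤ q * r := mul_nonneg hq.nonneg hr.nonneg
  have hl : q * r ≤ 1 := (hq.mul_le_right hr.nonneg).trans hr.le_one
  set d := (q * r) ⊓ (1 - q * r) with hd
  have hd0 : 0 ≤ d := le_inf hn (sub_nonneg.2 hl)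
  -- `d` is disjoint from both `1 - q` and `1 - r`, and lies below `(1 - q) + q * (1 - r)`.
  have a1 : d ⊓ (1 - q) = 0 := le_antisymm
    (by rw [← h1]; exact inf_le_inf_right _ (inf_le_left.trans (hr.mul_le_left hq.nonneg)))
    (le_inf hd0 hq.one_sub_nonneg)
  have a2 : d ⊓ (1 - r) = 0 := le_antisymm
    (by rw [← h2]; exact inf_le_inf_right _ (inf_le_left.trans (hq.mul_le_right hr.nonneg)))
    (le_inf hd0 hr.one_sub_nonneg)
  have b1 : d * (1 - q) = 0 := mul_eq_zero_of_inf_eq_zero a1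
  have b2 : (1 - r) * d = 0 := mul_eq_zero_of_inf_eq_zero (by rw [inf_comm]; exact a2)
  have b3 : (1 - q) * d = 0 := mul_eq_zero_of_inf_eq_zero (by rw [inf_comm]; exact a1)
  have c1 : r * d = d := by rw [sub_mul, one_mul, sub_eq_zero] at b2; exact b2.symm
  have c2 : q * d = d := by rw [sub_mul, one_mul, sub_eq_zero] at b3; exact b3.symm
  have c3 : (q * r) * d = d := by rw [mul_assoc, c1, c2]
  have c4 : (q * r) * d ≤ (q * r) * (1 - q * r) := mul_le_mul_of_nonneg_left inf_le_right hn
  rw [c3, e1] at c4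
  exact le_antisymm c4 hd0

/-- Multiplying by a component commutes with passing to upper bounds: it suffices to bound a
supremum on the component. -/
lemma mul_csSup_le (hq : IsUnitComponent q) {S : Set U} (hS : S.Nonempty) (hb : BddAbove S)
    {b : U} (h : ∀ s ∈ S, q * s ≤ q * b) : q * sSup S ≤ q * b := by
  have : sSup S ≤ q * b + (1 - q) * sSup S := by
    apply csSup_le hS
    intro s hs
    calc s = q * s + (1 - q) * s := by noncomm_ring
      _ ≤ _ := add_le_add (h s hs) (mul_le_mul_of_nonneg_left (le_csSup hb hs) hq.one_sub_nonneg)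
  have := mul_le_mul_of_nonneg_left this hq.nonneg
  rwa [mul_add, ← mul_assoc, ← mul_assoc, hq.mul_self, hq.mul_one_sub, zero_mul, add_zero] at this

/-- `|w|` is the supremum of `{w, -w}`, and suprema can be bounded on a component. -/
lemma mul_abs_le (hq : IsUnitComponent q) {w b : U} (h1 : q * w ≤ q * b) (h2 : -(q * b) ≤ q * w) :
    q * |w| ≤ q * b := by
  have := hq.mul_csSup_le (S := {w, -w}) (by simp) (Set.toFinite _).bddAbove (b := b) (by
    rintro s (rfl | rfl)
    · exact h1
    · rw [mul_neg]; exact neg_le.1 h2)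
  rwa [csSup_pair] at this

end IsUnitComponent

/-! ### Band projections of the unit -/

lemma bddAbove_bandProj (v : U) : BddAbove (Set.range fun n : ℕ => (1 : U) ⊓ n • v) :=
  ⟨1, by rintro _ ⟨n, rfl⟩; exact inf_le_left⟩

lemma inf_nsmul_le_bandProj (v : U) (n : ℕ) : 1 ⊓ n • v ≤ bandProj v 1 :=
  le_csSup (bddAbove_bandProj v) ⟨n, rfl⟩

lemma bandProj_le_one (v : U) : bandProj v 1 ≤ 1 :=
  csSup_le (Set.range_nonempty _) (by rintro _ ⟨n, rfl⟩; exact inf_le_left)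

lemma bandProj_nonneg (v : U) : 0 ≤ bandProj v 1 := by
  simpa using inf_nsmul_le_bandProj v 0

/-- An element disjoint from `v` is disjoint from the band generated by `v`. -/
lemma bandProj_inf_eq_zero {v d : U} (h : v ⊓ d = 0) : bandProj v 1 ⊓ d = 0 := by
  have hv : 0 ≤ v := h ▸ inf_le_left
  have hd : 0 ≤ d := h ▸ inf_le_right
  set w := bandProj v 1 ⊓ d with hw
  have hw0 : 0 ≤ w := le_inf (bandProj_nonneg v) hd
  refine le_antisymm ?_ hw0
  -- Disjoint elements have sum equal to their join, so adding `w` to any `1 ⊓ n • v` stays below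
  -- the supremum.
  have : bandProj v 1 ≤ bandProj v 1 - w := by
    apply csSup_le (Set.range_nonempty _)
    rintro _ ⟨n, rfl⟩
    have h0 : ((1 : U) ⊓ n • v) ⊓ w = 0 := le_antisymm
      (by rw [← nsmul_inf_eq_zero h n]; exact inf_le_inf inf_le_right inf_le_right)
      (le_inf (le_inf zero_le_one (nsmul_nonneg hv n)) hw0)
    have h1 := inf_add_sup ((1 : U) ⊓ n • v) w
    rw [h0, zero_add] at h1
    rw [le_sub_iff_add_le]
    change (1 : U) ⊓ n • v + w ≤ _
    rw [← h1]
    exact sup_le (inf_nsmul_le_bandProj v n) inf_le_left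
  simpa using this

/-- Adding the infimum to `1 ⊓ n • v` gives something below `1 ⊓ (n + 1) • v`, so the supremum
absorbs it. -/
lemma inf_one_sub_bandProj {v : U} (hv : 0 ≤ v) : v ⊓ (1 - bandProj v 1) = 0 := by
  set d := v ⊓ (1 - bandProj v 1) with hd
  refine le_antisymm ?_ (le_inf hv (sub_nonneg.2 (bandProj_le_one v)))
  have : bandProj v 1 ≤ bandProj v 1 - d := by
    apply csSup_le (Set.range_nonempty _)
    rintro _ ⟨n, rfl⟩
    rw [le_sub_iff_add_le]
    refine le_trans (le_inf ?_ ?_) (inf_nsmul_le_bandProj v (n + 1))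
    · calc _ ≤ bandProj v 1 + (1 - bandProj v 1) :=
            add_le_add (inf_nsmul_le_bandProj v n) inf_le_right
        _ = 1 := by abel
    · rw [succ_nsmul]; exact add_le_add inf_le_right inf_le_left
  simpa using this

lemma isUnitComponent_bandProj {v : U} (hv : 0 ≤ v) : IsUnitComponent (bandProj v 1) :=
  bandProj_inf_eq_zero (inf_one_sub_bandProj hv)

/-- The projection onto the band of the positive part kills the negative part. -/
lemma bandProj_mul_nonneg (w : U) : 0 ≤ bandProj (w ⊔ 0) 1 * w := by
  have h : (w ⊔ 0) ⊓ (-w ⊔ 0) = 0 := by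
    have := posPart_inf_negPart_eq_zero w
    simpa [posPart_def, negPart_def] using this
  have h1 := mul_eq_zero_of_inf_eq_zero (bandProj_inf_eq_zero h)
  have h2 : bandProj (w ⊔ 0) 1 * (-w) ≤ bandProj (w ⊔ 0) 1 * (-w ⊔ 0) :=
    mul_le_mul_of_nonneg_left le_sup_left (bandProj_nonneg _)
  rw [h1, mul_neg] at h2
  exact neg_nonpos.1 h2

lemma one_sub_bandProj_mul_nonpos (w : U) : (1 - bandProj (w ⊔ 0) 1) * w ≤ 0 := by
  have h := inf_one_sub_bandProj (v := w ⊔ 0) le_sup_right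
  rw [inf_comm] at h
  exact (mul_le_mul_of_nonneg_left le_sup_left (sub_nonneg.2 (bandProj_le_one _))).trans
    (mul_eq_zero_of_inf_eq_zero h).le

lemma le_zero_of_bandProj_eq_zero {w : U} (h : bandProj (w ⊔ 0) 1 = 0) : w ≤ 0 := by
  have h1 := inf_one_sub_bandProj (v := w ⊔ 0) le_sup_right
  rw [h, sub_zero] at h1
  have h2 := mul_eq_zero_of_inf_eq_zero h1
  rw [mul_one] at h2
  calc w ≤ w ⊔ 0 := le_sup_left
    _ = 0 := h2

/-! ### Spectral systems and localisation -/

section Spectral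

variable [Algebra ℝ U] [IsOrderedModule ℝ U] {q : U} {z : U}

lemma isUnitComponent_spectralSystem (z : U) (t : ℝ) : IsUnitComponent (spectralSystem 1 z t) :=
  (isUnitComponent_bandProj le_sup_right).one_sub

lemma spectralSystem_mul_le (z : U) (t : ℝ) :
    spectralSystem 1 z t * z ≤ t • spectralSystem 1 z t := by
  have := one_sub_bandProj_mul_nonpos (z - t • (1 : U))
  rwa [mul_sub, mul_smul_comm, mul_one, sub_nonpos] at this

lemma le_one_sub_spectralSystem_mul (z : U) (t : ℝ) :
    t • (1 - spectralSystem 1 z t) ≤ (1 - spectralSystem 1 z t) * z := by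
  have := bandProj_mul_nonneg (z - t • (1 : U))
  rw [mul_sub, mul_smul_comm, mul_one, sub_nonneg] at this
  simpa [spectralSystem] using this

/-- This is how inequalities in `U` are turned back into inequalities between reals. -/
lemma IsUnitComponent.le_of_smul_le (hq : IsUnitComponent q) (h0 : q ≠ 0) {a b : ℝ}
    (h : a • q ≤ b • q) : a ≤ b := by
  by_contra! hab
  have h1 : (a - b) • q ≤ 0 := by rw [sub_smul]; exact sub_nonpos.2 h
  have h2 : (a - b)⁻¹ • ((a - b) • q) ≤ (a - b)⁻¹ • 0 :=
    smul_le_smul_of_nonneg_left h1 (inv_nonneg.2 (sub_pos.2 hab).le)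
  rw [smul_smul, inv_mul_cancel₀ (sub_pos.2 hab).ne', one_smul, smul_zero] at h2
  exact h0 (le_antisymm h2 hq.nonneg)

lemma IsUnitComponent.eq_zero_of_smul_le (hq : IsUnitComponent q) {a b : ℝ} (hab : b < a)
    (h : a • q ≤ b • q) : q = 0 := by
  by_contra h0
  exact hab.not_ge (hq.le_of_smul_le h0 h)

/-- Order bounds on a component pass to smaller components. -/
lemma IsUnitComponent.mul_mul_le {r : U} (hr : IsUnitComponent r) {b : ℝ}
    (h : q * z ≤ b • q) : r * q * z ≤ b • (r * q) := by
  rw [mul_assoc, ← mul_smul_comm]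
  exact mul_le_mul_of_nonneg_left h hr.nonneg

lemma IsUnitComponent.le_mul_mul {r : U} (hr : IsUnitComponent r) {b : ℝ}
    (h : b • q ≤ q * z) : b • (r * q) ≤ r * q * z := by
  rw [mul_assoc, ← mul_smul_comm]
  exact mul_le_mul_of_nonneg_left h hr.nonneg

/-- On the product, `z` would be both at least `a` and at most `t < a`. -/
lemma mul_spectralSystem_eq_zero (hq : IsUnitComponent q) {a t : ℝ} (hat : t < a)
    (h : a • q ≤ q * z) : q * spectralSystem 1 z t = 0 := by
  have hs := isUnitComponent_spectralSystem z t
  apply (hq.mul hs).eq_zero_of_smul_le hat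
  refine le_trans ?_ (hq.mul_mul_le (spectralSystem_mul_le z t))
  rw [hq.mul_comm hs]
  exact hs.le_mul_mul h

lemma mul_spectralSystem_eq_self (hq : IsUnitComponent q) {b t : ℝ} (hbt : b < t)
    (h : q * z ≤ b • q) : q * spectralSystem 1 z t = q := by
  have hs := (isUnitComponent_spectralSystem z t).one_sub
  have : q * (1 - spectralSystem 1 z t) = 0 := by
    apply (hq.mul hs).eq_zero_of_smul_le hbt
    refine le_trans (hq.le_mul_mul (le_one_sub_spectralSystem_mul z t)) ?_
    rw [hq.mul_comm hs]
    exact hs.mul_mul_le h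
  rw [mul_sub, mul_one, sub_eq_zero] at this
  exact this.symm

lemma spectralSystem_mul_of_lt (z : U) {a b : ℝ} (hab : a < b) :
    spectralSystem 1 z a * spectralSystem 1 z b = spectralSystem 1 z a :=
  mul_spectralSystem_eq_self (isUnitComponent_spectralSystem z a) hab (spectralSystem_mul_le z a)

lemma spectralSystem_mul_of_le (z : U) {a b : ℝ} (hab : a ≤ b) :
    spectralSystem 1 z a * spectralSystem 1 z b = spectralSystem 1 z a := by
  rcases hab.eq_or_lt with rfl | h
  · exact (isUnitComponent_spectralSystem z a).mul_self
  · exact spectralSystem_mul_of_lt z h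

lemma spectralSystem_sub_eq (z : U) {a b : ℝ} (hab : a ≤ b) :
    spectralSystem 1 z b - spectralSystem 1 z a =
      (1 - spectralSystem 1 z a) * spectralSystem 1 z b := by
  rw [sub_mul, one_mul, spectralSystem_mul_of_le z hab]

lemma isUnitComponent_spectralSystem_sub (z : U) {a b : ℝ} (hab : a ≤ b) :
    IsUnitComponent (spectralSystem 1 z b - spectralSystem 1 z a) := by
  rw [spectralSystem_sub_eq z hab]
  exact (isUnitComponent_spectralSystem z a).one_sub.mul (isUnitComponent_spectralSystem z b)

lemma spectralSystem_sub_mul_le (z : U) {a b : ℝ} (hab : a ≤ b) :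
    (spectralSystem 1 z b - spectralSystem 1 z a) * z ≤
      b • (spectralSystem 1 z b - spectralSystem 1 z a) := by
  rw [spectralSystem_sub_eq z hab]
  exact (isUnitComponent_spectralSystem z a).one_sub.mul_mul_le (spectralSystem_mul_le z b)

lemma le_spectralSystem_sub_mul (z : U) {a b : ℝ} (hab : a ≤ b) :
    a • (spectralSystem 1 z b - spectralSystem 1 z a) ≤
      (spectralSystem 1 z b - spectralSystem 1 z a) * z := by
  have ha := (isUnitComponent_spectralSystem z a).one_sub
  have hb := isUnitComponent_spectralSystem z b
  rw [spectralSystem_sub_eq z hab, ha.mul_comm hb]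
  exact hb.le_mul_mul (le_one_sub_spectralSystem_mul z a)

lemma spectralSystem_sub_inf_eq_zero (z : U) {a b c d : ℝ} (hab : a ≤ b) (hbc : b ≤ c)
    (hcd : c ≤ d) : (spectralSystem 1 z b - spectralSystem 1 z a) ⊓
      (spectralSystem 1 z d - spectralSystem 1 z c) = 0 := by
  rw [← (isUnitComponent_spectralSystem_sub z hab).mul_eq_inf
    (isUnitComponent_spectralSystem_sub z hcd), sub_mul, mul_sub, mul_sub,
    spectralSystem_mul_of_le z (hab.trans hbc), spectralSystem_mul_of_le z hbc,
    spectralSystem_mul_of_le z ((hab.trans hbc).trans hcd),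
    spectralSystem_mul_of_le z (hbc.trans hcd)]
  simp

/-- An element that is not `≤ 0` is bounded below by a positive constant on some component. -/
lemma exists_component_smul_le {u : U} (hu : ¬ u ≤ 0) :
    ∃ q : U, IsUnitComponent q ∧ q ≠ 0 ∧ ∃ δ : ℝ, 0 < δ ∧ δ • q ≤ q * u := by
  by_contra! h
  apply hu
  have key : ∀ δ : ℝ, 0 < δ → u ≤ δ • (1 : U) := by
    intro δ hδ
    by_contra hc
    have hne : bandProj ((u - δ • (1 : U)) ⊔ 0) 1 ≠ 0 := fun h0 =>
      hc (sub_nonpos.1 (le_zero_of_bandProj_eq_zero h0))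
    refine h _ (isUnitComponent_bandProj le_sup_right) hne δ hδ ?_
    have := bandProj_mul_nonneg (u - δ • (1 : U))
    rwa [mul_sub, mul_smul_comm, mul_one, sub_nonneg] at this
  apply nonpos_of_forall_nsmul_le (y := (1 : U))
  intro n
  rcases Nat.eq_zero_or_pos n with rfl | hn
  · simp
  · have hn' : (0 : ℝ) < n := by exact_mod_cast hn
    have := nsmul_le_nsmul_right (key (n : ℝ)⁻¹ (inv_pos.2 hn')) n
    rwa [← Nat.cast_smul_eq_nsmul ℝ n ((n : ℝ)⁻¹ • (1 : U)), smul_smul, mul_inv_cancel₀ hn'.ne',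
      one_smul] at this

lemma IsUnitComponent.eq_zero_of_forall_smul_le (hq : IsUnitComponent q) {ε : ℝ} (hε : 0 < ε)
    {y : U} (h : ∀ n : ℕ, (n * ε) • q ≤ y) : q = 0 := by
  refine le_antisymm (nonpos_of_forall_nsmul_le (y := ε⁻¹ • y) fun n => ?_) hq.nonneg
  have := smul_le_smul_of_nonneg_left (h n) (inv_nonneg.2 hε.le)
  rwa [smul_smul, _root_.mul_comm, mul_assoc, mul_inv_cancel₀ hε.ne', mul_one,
    Nat.cast_smul_eq_nsmul] at this

/-- Every nonzero component meets some cell of the spectral grid of mesh `ε`. -/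
lemma exists_mul_spectralSystem_sub_ne_zero (hq : IsUnitComponent q) (h0 : q ≠ 0) (z : U) {ε : ℝ}
    (hε : 0 < ε) : ∃ k : ℤ, q * (spectralSystem 1 z ((k + 1) * ε) -
      spectralSystem 1 z (k * ε)) ≠ 0 := by
  by_contra! h
  have hstep : ∀ k : ℤ, q * spectralSystem 1 z ((k + 1) * ε) = q * spectralSystem 1 z (k * ε) :=
    fun k => by simpa [mul_sub, sub_eq_zero] using h k
  -- If `q` misses every cell, its spectral values agree along the whole grid. Going to `-∞` makes
  -- this common value zero, and going to `+∞` then makes `q` zero.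
  have hconst : ∀ k : ℤ, q * spectralSystem 1 z (k * ε) = q * spectralSystem 1 z 0 := by
    intro k
    induction k using Int.induction_on with
    | zero => simp
    | succ n ih => rw [← ih, ← hstep (n : ℤ)]; push_cast; rfl
    | pred n ih => rw [← ih, ← hstep]; push_cast; simp
  have hs := isUnitComponent_spectralSystem z 0
  have h1 : q * spectralSystem 1 z 0 = 0 := by
    refine (hq.mul hs).eq_zero_of_forall_smul_le hε (y := -(q * spectralSystem 1 z 0 * z))
      fun n => ?_
    have := hq.mul_mul_le (spectralSystem_mul_le z ((-n : ℤ) * ε))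
    rw [hconst] at this
    rw [le_neg, ← neg_smul]
    simpa using this
  have h2 : q = 0 := by
    refine hq.eq_zero_of_forall_smul_le hε (y := q * z) fun n => ?_
    have := hq.le_mul_mul (le_one_sub_spectralSystem_mul z ((n : ℤ) * ε))
    rw [mul_sub, hconst, h1] at this
    simpa using this
  exact h0 h2

/-- Every nonzero component contains one on which `z` is constant up to `ε`. -/
lemma exists_component_near_const (hq : IsUnitComponent q) (h0 : q ≠ 0) (z : U) {ε : ℝ}
    (hε : 0 < ε) : ∃ r : U, IsUnitComponent r ∧ r ≠ 0 ∧ r * q = r ∧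
      ∃ c : ℝ, c • r ≤ r * z ∧ r * z ≤ (c + ε) • r := by
  obtain ⟨k, hk⟩ := exists_mul_spectralSystem_sub_ne_zero hq h0 z hε
  have hab : (k : ℝ) * ε ≤ (k + 1) * ε := by nlinarith
  have hr := isUnitComponent_spectralSystem_sub z hab
  refine ⟨_, hq.mul hr, hk, ?_, k * ε, hq.le_mul_mul (le_spectralSystem_sub_mul z hab), ?_⟩
  · rw [mul_assoc, hr.mul_comm hq, ← mul_assoc, hq.mul_self]
  · have := hq.mul_mul_le (spectralSystem_sub_mul_le z hab)
    rwa [add_mul (k : ℝ), one_mul] at this ⊢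

/-! ### Functional calculus: local bounds and existence -/

variable {f : ℝ → ℝ}

lemma zero_mem_lowerSpectralSums (z : U) (f : ℝ → ℝ) : (0 : U) ∈ lowerSpectralSums 1 z f :=
  ⟨0, fun _ => 0, fun _ => 0, monotone_const, by simp, by simp⟩

/-- If `z ≤ b` on the component `q`, then all lower sums are at most `f b'` on `q`, for `b < b'`. -/
lemma mul_lowerSpectralSum_le (hf : Monotone f) (hf0 : ∀ t, 0 ≤ f t) (hq : IsUnitComponent q)
    {b b' : ℝ} (hb : b < b') (h : q * z ≤ b • q) {s : U} (hs : s ∈ lowerSpectralSums 1 z f) :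
    q * s ≤ f b' • q := by
  obtain ⟨n, t, c, ht, hc, rfl⟩ := hs
  have hterm : ∀ i ∈ Finset.range n,
      q * (c i • (spectralSystem 1 z (t (i + 1)) - spectralSystem 1 z (t i))) ≤
        f b' • (q * (spectralSystem 1 z (t (i + 1)) - spectralSystem 1 z (t i))) := by
    intro i hi
    have hle := ht (Nat.le_succ i)
    have hr := isUnitComponent_spectralSystem_sub z hle
    rw [mul_smul_comm]
    rcases hle.eq_or_lt with heq | hlt
    -- On an empty cell `c i` is unconstrained, but the spectral increment vanishes.
    · simp [← Nat.succ_eq_add_one, ← heq]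
    rcases lt_or_ge (t i) b' with hib | hib
    · refine smul_le_smul_of_nonneg_right ?_ (mul_nonneg hq.nonneg hr.nonneg)
      -- The test point must lie in the half-open cell and not exceed `b'`; cells starting at or
      -- beyond `b'` vanish on `q`.
      exact (hc i (Finset.mem_range.1 hi) (min (t (i + 1)) b')
        ⟨lt_min hlt hib, min_le_left _ _⟩).trans (hf (min_le_right _ _))
    · rw [mul_sub, mul_spectralSystem_eq_self hq (hb.trans_le hib) h,
        mul_spectralSystem_eq_self hq (hb.trans_le (hib.trans hle)) h]
      simp
  rw [Finset.mul_sum]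
  refine (Finset.sum_le_sum hterm).trans ?_
  rw [← Finset.smul_sum, ← Finset.mul_sum,
    Finset.sum_range_sub (fun i => spectralSystem 1 z (t i))]
  exact smul_le_smul_of_nonneg_left
    ((isUnitComponent_spectralSystem_sub z (ht (Nat.zero_le n))).mul_le_left hq.nonneg) (hf0 _)

lemma mul_functionalCalculus_le (hf : Monotone f) (hf0 : ∀ t, 0 ≤ f t)
    (hbdd : BddAbove (lowerSpectralSums 1 z f)) (hq : IsUnitComponent q)
    {b b' : ℝ} (hb : b < b') (h : q * z ≤ b • q) : q * functionalCalculus 1 z f ≤ f b' • q := by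
  have := hq.mul_csSup_le ⟨0, zero_mem_lowerSpectralSums z f⟩ hbdd (b := f b' • (1 : U))
    (fun s hs => by simpa using mul_lowerSpectralSum_le hf hf0 hq hb h hs)
  simpa [functionalCalculus] using this

lemma le_mul_functionalCalculus (hf : Monotone f)
    (hbdd : BddAbove (lowerSpectralSums 1 z f)) (hq : IsUnitComponent q)
    {a a' b : ℝ} (ha : a' < a) (h : a • q ≤ q * z) (h' : q * z ≤ b • q) :
    f a' • q ≤ q * functionalCalculus 1 z f := by
  -- A single step of height `f a'` on `(a', M]` suffices: on `q` its spectral increment is all of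
  -- `q`.
  set M := max a' (b + 1)
  have hM : b < M := (lt_add_one b).trans_le (le_max_right _ _)
  have hmem : f a' • (spectralSystem 1 z M - spectralSystem 1 z a') ∈ lowerSpectralSums 1 z f := by
    refine ⟨1, fun i => if i = 0 then a' else M, fun _ => f a', ?_, ?_, by simp⟩
    · refine monotone_nat_of_le_succ fun i => ?_
      rcases i with _ | i <;> simp [M]
    · intro i hi s hs
      obtain rfl : i = 0 := by omega
      exact hf (by simpa using hs.1.le)
  have := mul_le_mul_of_nonneg_left (le_csSup hbdd hmem) hq.nonneg
  rwa [mul_smul_comm, mul_sub, mul_spectralSystem_eq_self hq hM h',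
    mul_spectralSystem_eq_zero hq ha h, sub_zero] at this

/-- In a laterally complete f-algebra the integral of a monotone nonnegative function against any
spectral system exists. -/
lemma bddAbove_lowerSpectralSums (hU : IsLaterallyComplete U) (hf : Monotone f)
    (hf0 : ∀ t, 0 ≤ f t) (z : U) : BddAbove (lowerSpectralSums 1 z f) := by
  have hle : ∀ k : ℤ, (k : ℝ) * 1 ≤ (k + 1) * 1 := fun k => by linarith
  set r : ℤ → U := fun k => spectralSystem 1 z ((k + 1) * 1) - spectralSystem 1 z (k * 1) with hr
  have hrc : ∀ k, IsUnitComponent (r k) := fun k => isUnitComponent_spectralSystem_sub z (hle k)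
  have hlt : ∀ k l : ℤ, k < l → r k ⊓ r l = 0 := fun k l hkl =>
    spectralSystem_sub_inf_eq_zero z (hle k) (by simpa using (by exact_mod_cast hkl)) (hle l)
  have hdis : ∀ k l : ℤ, k ≠ l → r k ⊓ r l = 0 := fun k l hkl => by
    rcases hkl.lt_or_gt with h | h
    · exact hlt k l h
    · rw [inf_comm]; exact hlt l k h
  -- On cell `k` one has `z ≤ k + 1`; the value at `k + 2` leaves the strict gap that
  -- `mul_lowerSpectralSum_le` needs.
  obtain ⟨b, hb⟩ := hU (Set.range fun k : ℤ => f (k + 2) • r k) (Set.range_nonempty _)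
    (by rintro _ ⟨k, rfl⟩; exact smul_nonneg (hf0 _) (hrc k).nonneg)
    (by
      rintro _ ⟨k, rfl⟩ _ ⟨l, rfl⟩ hne
      have hkl : k ≠ l := by rintro rfl; exact hne rfl
      have hone : ∀ c : ℝ, 0 ≤ c → (0 : U) ≤ c • (1 : U) := fun c hc => smul_nonneg hc zero_le_one
      have h1 := IsFAlgebra.mul_left_disjoint _ _ _ (hdis k l hkl) (hone _ (hf0 (k + 2)))
      rw [inf_comm] at h1
      have h2 := IsFAlgebra.mul_left_disjoint _ _ _ h1 (hone _ (hf0 (l + 2)))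
      rw [inf_comm] at h2
      simpa using h2)
  refine ⟨b, fun s hs => ?_⟩
  by_contra hsb
  obtain ⟨q, hq, hq0, δ, hδ, hqδ⟩ := exists_component_smul_le (fun h => hsb (sub_nonpos.1 h))
  obtain ⟨k, hk⟩ := exists_mul_spectralSystem_sub_ne_zero hq hq0 z one_pos
  change q * r k ≠ 0 at hk
  rw [hq.mul_comm (hrc k)] at hk
  have hc := (hrc k).mul hq
  have h1 := (hrc k).le_mul_mul hqδ
  have hkz : (r k * q) * z ≤ ((k : ℝ) + 1) • (r k * q) := by
    rw [← hq.mul_comm (hrc k)]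
    rw [← mul_one ((k : ℝ) + 1)]
    exact hq.mul_mul_le (spectralSystem_sub_mul_le z (hle k))
  have h2 := mul_lowerSpectralSum_le hf hf0 hc (show (k : ℝ) + 1 < k + 2 by linarith) hkz hs
  have h3 : f (k + 2) • (r k * q) ≤ r k * q * b := by
    have := mul_le_mul_of_nonneg_left (hb.1 ⟨k, rfl⟩) hc.nonneg
    simp only [mul_smul_comm] at this
    rwa [← hq.mul_comm (hrc k), mul_assoc, (hrc k).mul_self, hq.mul_comm (hrc k)] at this
  apply hk
  apply hc.eq_zero_of_smul_le hδ
  rw [zero_smul]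
  refine h1.trans ?_
  rw [mul_sub]
  exact sub_nonpos.2 (h2.trans h3)

lemma IsUnitComponent.mul_abs_le_smul (hq : IsUnitComponent q) {c d : ℝ}
    (h1 : (c - d) • q ≤ q * z) (h2 : q * z ≤ (c + d) • q) : q * |z| ≤ (|c| + d) • q := by
  have := hq.mul_abs_le (w := z) (b := (|c| + d) • (1 : U)) ?_ ?_
  · simpa using this
  · rw [mul_smul_comm, mul_one]
    exact h2.trans (smul_le_smul_of_nonneg_right (by linarith [le_abs_self c]) hq.nonneg)
  · rw [mul_smul_comm, mul_one, ← neg_smul]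
    exact (smul_le_smul_of_nonneg_right (by linarith [neg_abs_le c]) hq.nonneg).trans h1

lemma IsUnitComponent.smul_le_mul_abs (hq : IsUnitComponent q) {c d : ℝ}
    (h1 : (c - d) • q ≤ q * z) (h2 : q * z ≤ (c + d) • q) : (|c| - d) • q ≤ q * |z| := by
  rcases abs_cases c with ⟨hc, -⟩ | ⟨hc, -⟩
  · rw [hc]
    exact h1.trans (mul_le_mul_of_nonneg_left (le_abs_self z) hq.nonneg)
  · rw [hc]
    have h3 : (-c - d) • q ≤ q * (-z) := by
      rw [mul_neg, le_neg, ← neg_smul]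
      convert h2 using 2
      ring
    exact h3.trans (mul_le_mul_of_nonneg_left (neg_le_abs z) hq.nonneg)

/-- If `z` is within `d` of the constant `c` on the component `q`, then `f |z|` lies between
`f (|c| - d')` and `f (|c| + d')` on `q`, for `d < d'`. -/
lemma mul_functionalCalculus_abs_bounds (hf : Monotone f) (hf0 : ∀ t, 0 ≤ f t)
    (hbdd : BddAbove (lowerSpectralSums 1 |z| f)) (hq : IsUnitComponent q) {c d d' : ℝ}
    (hd : d < d') (h1 : (c - d) • q ≤ q * z) (h2 : q * z ≤ (c + d) • q) :
    f (|c| - d') • q ≤ q * functionalCalculus 1 |z| f ∧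
      q * functionalCalculus 1 |z| f ≤ f (|c| + d') • q :=
  ⟨le_mul_functionalCalculus hf hbdd hq (by linarith) (hq.smul_le_mul_abs h1 h2)
      (hq.mul_abs_le_smul h1 h2),
    mul_functionalCalculus_le hf hf0 hbdd hq (by linarith) (hq.mul_abs_le_smul h1 h2)⟩

end Spectral

end FAlgebra

/-! ### Powers and Clarkson's inequality -/

section Power

lemma powFun_nonneg (p t : ℝ) : 0 ≤ powFun p t := Real.rpow_nonneg (le_max_right _ _) _

lemma powFun_abs (p t : ℝ) : powFun p |t| = |t| ^ p := by
  rw [powFun, max_eq_left (abs_nonneg t)]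

lemma monotone_powFun {p : ℝ} (hp : 0 ≤ p) : Monotone (powFun p) := fun _ _ h =>
  Real.rpow_le_rpow (le_max_right _ _) (max_le_max_right 0 h) hp

lemma continuous_powFun {p : ℝ} (hp : 0 ≤ p) : Continuous (powFun p) :=
  (continuous_id.max continuous_const).rpow_const fun _ => Or.inr hp

lemma abs_rpow_eq_sq_rpow (p a : ℝ) : |a| ^ p = (a ^ 2) ^ (p / 2) := by
  rw [← sq_abs, ← Real.rpow_natCast, ← Real.rpow_mul (abs_nonneg a)]
  congr 1
  push_cast
  ring

/-- Clarkson's inequality for real numbers. -/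
lemma abs_add_rpow_add_abs_sub_rpow_le {p : ℝ} (hp0 : 0 ≤ p) (hp2 : p ≤ 2) (a b : ℝ) :
    |a + b| ^ p + |a - b| ^ p ≤ 2 * (|a| ^ p + |b| ^ p) := by
  simp only [abs_rpow_eq_sq_rpow]
  -- Concavity of `t ^ (p / 2)` at the squares of `a + b` and `a - b`, whose mean is `a ^ 2 + b ^
  -- 2`; subadditivity then splits that sum.
  have h1 := (Real.concaveOn_rpow (p := p / 2) (by linarith) (by linarith)).2
    (Set.mem_Ici.2 (sq_nonneg (a + b))) (Set.mem_Ici.2 (sq_nonneg (a - b)))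
    (by norm_num : (0 : ℝ) ≤ 1 / 2) (by norm_num : (0 : ℝ) ≤ 1 / 2) (by norm_num)
  have h2 := Real.rpow_add_le_add_rpow (sq_nonneg a) (sq_nonneg b)
    (by linarith : 0 ≤ p / 2) (by linarith)
  simp only [smul_eq_mul] at h1
  rw [show 1 / 2 * (a + b) ^ 2 + 1 / 2 * (a - b) ^ 2 = a ^ 2 + b ^ 2 by ring] at h1
  linarith

/-- Clarkson's inequality in a laterally complete unital f-algebra. -/
lemma rieszPow_add_rieszPow_sub_le {U : Type*} [ConditionallyCompleteLattice U] [Ring U]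
    [IsOrderedRing U] [IsFAlgebra U] [Algebra ℝ U] [IsOrderedModule ℝ U]
    (hU : IsLaterallyComplete U) {p : ℝ} (hp0 : 0 ≤ p) (hp2 : p ≤ 2) (x y : U) :
    rieszPow 1 |x + y| p + rieszPow 1 |x - y| p ≤
      2 * (rieszPow 1 |x| p + rieszPow 1 |y| p) := by
  by_contra hcon
  obtain ⟨q, hq, hq0, δ, hδ, hqδ⟩ :=
    exists_component_smul_le (fun h => hcon (sub_nonpos.1 h))
  -- A coarse localisation comes first: it confines all values to a fixed compact interval, so that
  -- the modulus `η`, and hence `ε`, can be chosen before the fine one.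
  obtain ⟨q₁, hq₁, hq₁0, hq₁q, c₁, hc₁, hc₁'⟩ := exists_component_near_const hq hq0 x one_pos
  obtain ⟨q₂, hq₂, hq₂0, hq₂q, c₂, hc₂, hc₂'⟩ := exists_component_near_const hq₁ hq₁0 y one_pos
  set M := |c₁| + |c₂| + 10
  obtain ⟨η, hη, hunif⟩ := Metric.uniformContinuousOn_iff.1
    (isCompact_Icc.uniformContinuousOn_of_continuous (s := Set.Icc (-M) M)
      -- Six errors will be added: one for each power on the left, and two for each on the right.
      (continuous_powFun hp0).continuousOn) (δ / 6) (by positivity)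
  set ε := min 1 (η / 4)
  have hε : 0 < ε := lt_min one_pos (by positivity)
  have hε1 : ε ≤ 1 := min_le_left _ _
  have hεη : 3 * ε < η := by linarith [min_le_right 1 (η / 4)]
  obtain ⟨q₃, hq₃, hq₃0, hq₃q, α, hα, hα'⟩ := exists_component_near_const hq₂ hq₂0 x hε
  obtain ⟨r, hr, hr0, hrq₃, β, hβ, hβ'⟩ := exists_component_near_const hq₃ hq₃0 y hε
  have hrq₂ : r * q₂ = r := by rw [← hrq₃, mul_assoc, hq₃q]
  have hrq₁ : r * q₁ = r := by rw [← hrq₂, mul_assoc, hq₂q]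
  have hrq : r * q = r := by rw [← hrq₁, mul_assoc, hq₁q]
  have hδr := hr.le_mul_mul hqδ
  have hx₁ := hr.le_mul_mul hc₁
  have hx₁' := hr.mul_mul_le hc₁'
  have hy₂ := hr.le_mul_mul hc₂
  have hy₂' := hr.mul_mul_le hc₂'
  have hx := hr.le_mul_mul hα
  have hx' := hr.mul_mul_le hα'
  rw [hrq] at hδr
  rw [hrq₁] at hx₁ hx₁'
  rw [hrq₂] at hy₂ hy₂'
  rw [hrq₃] at hx hx'
  have k1 := hr.le_of_smul_le hr0 (hx.trans hx₁')
  have k2 := hr.le_of_smul_le hr0 (hx₁.trans hx')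
  have k3 := hr.le_of_smul_le hr0 (hβ.trans hy₂')
  have k4 := hr.le_of_smul_le hr0 (hy₂.trans hβ')
  have hαM : |α| ≤ |c₁| + 1 :=
    abs_le.2 ⟨by linarith [neg_abs_le c₁], by linarith [le_abs_self c₁]⟩
  have hβM : |β| ≤ |c₂| + 1 :=
    abs_le.2 ⟨by linarith [neg_abs_le c₂], by linarith [le_abs_self c₂]⟩
  have mono : ∀ {a b : ℝ}, a ≤ b → a • r ≤ b • r := fun h =>
    smul_le_smul_of_nonneg_right h hr.nonneg
  -- The errors in `x` and `y` add up to `2 * ε` for `x ± y`; `3 * ε` provides the strict gap.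
  have bounds := fun (w : U) (c : ℝ) (h1 : (c - 2 * ε) • r ≤ r * w)
    (h2 : r * w ≤ (c + 2 * ε) • r) => mul_functionalCalculus_abs_bounds (monotone_powFun hp0)
      (powFun_nonneg p) (bddAbove_lowerSpectralSums hU (monotone_powFun hp0) (powFun_nonneg p) _)
      hr (show 2 * ε < 3 * ε by linarith) h1 h2
  have bx := (bounds x α ((mono (by linarith)).trans hx) (hx'.trans (mono (by linarith)))).1
  have bY := (bounds y β ((mono (by linarith)).trans hβ) (hβ'.trans (mono (by linarith)))).1
  have badd := (bounds (x + y) (α + β)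
    (by rw [mul_add]; exact (mono (by linarith)).trans ((add_smul α β r).le.trans
          (add_le_add hx hβ)))
    (by
      rw [mul_add]
      refine (add_le_add hx' hβ').trans ?_
      rw [← add_smul]
      exact mono (by linarith))).2
  have bsub := (bounds (x - y) (α - β)
    (by
      rw [mul_sub]
      refine le_trans ?_ (sub_le_sub hx hβ')
      rw [← sub_smul]
      exact mono (by linarith))
    (by
      rw [mul_sub]
      refine (sub_le_sub hx' hβ).trans ?_
      rw [← sub_smul]
      exact mono (by linarith))).2
  have hfin : δ • r ≤ (powFun p (|α + β| + 3 * ε) + powFun p (|α - β| + 3 * ε) -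
      ((powFun p (|α| - 3 * ε) + powFun p (|β| - 3 * ε)) +
        (powFun p (|α| - 3 * ε) + powFun p (|β| - 3 * ε)))) • r := by
    refine hδr.trans ?_
    rw [two_mul, mul_sub, mul_add, mul_add, mul_add, sub_smul, add_smul, add_smul, add_smul]
    exact sub_le_sub (add_le_add badd bsub) (add_le_add (add_le_add bx bY) (add_le_add bx bY))
  have hreal := hr.le_of_smul_le hr0 hfin
  have hclose : ∀ c t : ℝ, |c| ≤ |c₁| + |c₂| + 2 → |t| = 3 * ε →
      |powFun p (|c| + t) - |c| ^ p| < δ / 6 := by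
    intro c t hc ht
    have ht' := abs_le.1 ht.le
    have h := hunif (|c| + t)
      ⟨by simp only [M]; linarith [abs_nonneg c, abs_nonneg c₁, abs_nonneg c₂],
        by simp only [M]; linarith⟩
      |c| ⟨by simp only [M]; linarith [abs_nonneg c, abs_nonneg c₁, abs_nonneg c₂],
        by simp only [M]; linarith⟩
      (by rw [Real.dist_eq]; simpa [ht] using hεη)
    rwa [Real.dist_eq, powFun_abs] at h
  have hpos : |3 * ε| = 3 * ε := abs_of_pos (by linarith)
  have hneg : |-(3 * ε)| = 3 * ε := by rw [abs_neg, hpos]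
  have e1 := abs_lt.1 (hclose (α + β) (3 * ε) (by linarith [abs_add_le α β]) hpos)
  have e2 := abs_lt.1 (hclose (α - β) (3 * ε) (by linarith [abs_sub α β]) hpos)
  have e3 := abs_lt.1 (hclose α (-(3 * ε)) (by linarith [abs_nonneg c₂]) hneg)
  have e4 := abs_lt.1 (hclose β (-(3 * ε)) (by linarith [abs_nonneg c₁]) hneg)
  rw [← sub_eq_add_neg] at e3 e4
  linarith [abs_add_rpow_add_abs_sub_rpow_le hp0 hp2 α β]

end Power

theorem theorem3p2
    -- a Dedekind complete Riesz space `E` with weak order unit `e`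
    {E : Type*} [ConditionallyCompleteLattice E] [AddCommGroup E] [IsOrderedAddMonoid E]
    [Module ℝ E] [IsOrderedModule ℝ E] (e : E) (he : IsWeakOrderUnit e)
    -- its universal completion `U`, an f-algebra with multiplicative unit `e`
    {U : Type*} [ConditionallyCompleteLattice U] [Ring U] [IsOrderedAddMonoid U]
    [Algebra ℝ U] [IsOrderedModule ℝ U] [IsFAlgebra U]
    (ι : E →ₗ[ℝ] U) (hι : IsUniversalCompletion ι) (hunit : ι e = 1)
    (p : ℝ) (hp1 : 1 ≤ p) (hp2 : p ≤ 2) (x y : U) :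
    -- the suprema defining the `p`-th powers exist in `U`
    (∀ z : U, BddAbove (lowerSpectralSums 1 |z| (powFun p))) ∧
    rieszPow 1 |x + y| p + rieszPow 1 |x - y| p ≤ 2 * (rieszPow 1 |x| p + rieszPow 1 |y| p) := by
  -- Positivity of the unit is inherited from `e` through the Riesz homomorphism.
  have hone : (0 : U) ≤ 1 := by
    have h := hι.map_sup e 0
    rw [sup_eq_left.2 he.1, hunit, map_zero] at h
    exact left_eq_sup.1 h
  have : ZeroLEOneClass U := ⟨hone⟩
  have : IsOrderedRing U := .of_mul_nonneg IsFAlgebra.mul_nonneg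
  have hp0 : 0 ≤ p := zero_le_one.trans hp1
  exact ⟨fun z => bddAbove_lowerSpectralSums hι.laterallyComplete (monotone_powFun hp0)
    (powFun_nonneg p) |z|, rieszPow_add_rieszPow_sub_le hι.laterallyComplete hp0 hp2 x y⟩
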